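/- All rings are commutative with unit. Let $R$ be a commutative ring. For $r\in R$ let $R[r^{-1}]$ denote the localization of $R$ at the multiplicative set $\{1,r,r^2,\dots\}$, regarded as an $R$-module. An $R$-module $C$ is called contraadjusted if $\operatorname{Ext}^1_R(R[r^{-1}],C)=0$ for every $r\in R$. An $R$-module $F$ is called very flat if $\operatorname{Ext}^1_R(F,C)=0$ for every contraadjusted $R$-module $C$. Theorem. Let $R$ be a commutative ring and let $S$ be a finitely presented commutative $R$-algebra, i.e. $S\cong R[x_1,\dots,x_m]/I$ as an $R$-algebra for some integer $m\ge 0$ and some finitely generated ideal $I\subset R[x_1,\dots,x_m]$. Assume that $S$ is flat as an $R$-module. Then $S$ is a very flat $R$-module. -/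

import Mathlib

universe u

/-- An `R`-module `C` is `r`-contraadjusted if `Ext¹_R(R[r⁻¹], C) = 0`. -/
def IsContraadjustedAt (R : Type u) [CommRing R] (r : R)
    (C : Type u) [AddCommGroup C] [Module R C] : Prop :=
  Subsingleton (CategoryTheory.Abelian.Ext.{u}
    (ModuleCat.of R (Localization.Away r)) (ModuleCat.of R C) 1)

/-- An `R`-module `C` is contraadjusted if it is `r`-contraadjusted for every `r : R`. -/
def IsContraadjusted (R : Type u) [CommRing R]
    (C : Type u) [AddCommGroup C] [Module R C] : Prop :=
  ∀ r : R, IsContraadjustedAt R r C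

/-- An `R`-module `F` is very flat if `Ext¹_R(F, C) = 0` for every contraadjusted
`R`-module `C`. -/
def IsVeryFlat (R : Type u) [CommRing R]
    (F : Type u) [AddCommGroup F] [Module R F] : Prop :=
  ∀ (C : Type u) [AddCommGroup C] [Module R C], IsContraadjusted R C →
    Subsingleton (CategoryTheory.Abelian.Ext.{u} (ModuleCat.of R F) (ModuleCat.of R C) 1)

/-! Descend the presentation: S = R ⊗ S₀ with S₀ of finite type over a Noetherian ring R₀; flatness
is needed only over R. Noetherian induction on ideals I of R₀ shows Ext¹(S, C) = 0 for
contraadjusted C killed by I (`subsingleton_ext_one_of_baseChange`), and I = 0 is the theorem. If ab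
∈ I with a, b ∉ I, filter C by aC. If I is prime, generic freeness gives r ∉ I such that S₀/IS₀
becomes free over R₀/I after inverting r, so maps from S lift along surjections of modules killed by
I on which r is bijective.

The prime case is then a dévissage along r (`subsingleton_ext_one_of_forall_lift`). Embed C in Q,
the I-torsion of an injective module, with quotient L. Flatness gives Ext¹(S, Q) = 0, so the task is
to lift g : S → L to Q. By induction Ext¹(S, C) is r-divisible, so, after adding a map that lifts to
Q, g extends to a map S → Hom(R[r⁻¹], L). Contraadjustedness makes Hom(R[r⁻¹], Q) → Hom(R[r⁻¹], L)
surjective, and r is bijective on both, so generic freeness supplies the lift. -/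

open CategoryTheory Abelian TensorProduct
open scoped MonomialOrder

/-! ### Long exact sequences for Ext of modules -/

section ExtModule

variable {R : Type u} [CommRing R]

/-- The group `Extⁿ_R(F, C)` for modules `F` and `C`. -/
abbrev ModuleExt (R : Type u) [CommRing R] (F C : Type u) [AddCommGroup F] [Module R F]
    [AddCommGroup C] [Module R C] (n : ℕ) : Type u :=
  Abelian.Ext.{u} (ModuleCat.of R F) (ModuleCat.of R C) n

variable {F C Q L : Type u} [AddCommGroup F] [Module R F] [AddCommGroup C] [Module R C]
  [AddCommGroup Q] [Module R Q] [AddCommGroup L] [Module R L]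

/-- A short exact sequence of modules as a short complex in the category of modules. -/
abbrev moduleShortComplex (ι : C →ₗ[R] Q) (π : Q →ₗ[R] L) (H : Function.Exact ι π) :
    ShortComplex (ModuleCat.{u} R) :=
  ShortComplex.mk (ModuleCat.ofHom ι) (ModuleCat.ofHom π) (by
    ext x; exact H.apply_apply_eq_zero x)

lemma moduleShortComplex_shortExact {ι : C →ₗ[R] Q} {π : Q →ₗ[R] L} (H : Function.Exact ι π)
    (hι : Function.Injective ι) (hπ : Function.Surjective π) :
    (moduleShortComplex ι π H).ShortExact where
  exact := (ShortComplex.ShortExact.moduleCat_exact_iff_function_exact _).2 H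
  mono_f := (ModuleCat.mono_iff_injective _).2 hι
  epi_g := (ModuleCat.epi_iff_surjective _).2 hπ

variable {ι : C →ₗ[R] Q} {π : Q →ₗ[R] L}

lemma subsingleton_ext_one_of_lift (H : Function.Exact ι π)
    (hι : Function.Injective ι) (hπ : Function.Surjective π)
    (hQ : Subsingleton (ModuleExt R F Q 1))
    (hlift : ∀ g : F →ₗ[R] L, ∃ h : F →ₗ[R] Q, π ∘ₗ h = g) :
    Subsingleton (ModuleExt R F C 1) := by
  refine subsingleton_of_forall_eq 0 fun e ↦ ?_
  have hS := moduleShortComplex_shortExact H hι hπ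
  obtain ⟨x, rfl⟩ := Ext.covariant_sequence_exact₁ _ hS e (Subsingleton.elim _ _) (zero_add 1)
  obtain ⟨g, rfl⟩ := (Ext.mk₀_bijective _ _).2 x
  obtain ⟨h, hh⟩ := hlift g.hom
  have : g = ModuleCat.ofHom h ≫ ModuleCat.ofHom π := by
    ext x; simp [← hh]
  rw [this, ← Ext.mk₀_comp_mk₀, Ext.comp_assoc_of_second_deg_zero]
  erw [hS.comp_extClass]
  simp

lemma exists_lift_of_subsingleton_ext_one (H : Function.Exact ι π)
    (hι : Function.Injective ι) (hπ : Function.Surjective π)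
    (hC : Subsingleton (ModuleExt R F C 1)) (g : F →ₗ[R] L) :
    ∃ h : F →ₗ[R] Q, π ∘ₗ h = g := by
  have hS := moduleShortComplex_shortExact H hι hπ
  obtain ⟨x, hx⟩ := Ext.covariant_sequence_exact₃ _ hS (Ext.mk₀ (ModuleCat.ofHom g))
    (zero_add 1) (Subsingleton.elim _ _)
  obtain ⟨h, rfl⟩ := (Ext.mk₀_bijective _ _).2 x
  rw [Ext.mk₀_comp_mk₀] at hx
  have := (Ext.mk₀_bijective _ _).1 hx
  exact ⟨h.hom, by ext x; exact congr($(this).hom x)⟩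

lemma subsingleton_ext_middle (H : Function.Exact ι π)
    (hι : Function.Injective ι) (hπ : Function.Surjective π) (n : ℕ)
    (hC : Subsingleton (ModuleExt R F C n)) (hL : Subsingleton (ModuleExt R F L n)) :
    Subsingleton (ModuleExt R F Q n) := by
  refine subsingleton_of_forall_eq 0 fun e ↦ ?_
  have hS := moduleShortComplex_shortExact H hι hπ
  obtain ⟨x, rfl⟩ := Ext.covariant_sequence_exact₂ _ hS e (Subsingleton.elim _ _)
  rw [Subsingleton.elim x 0]
  simp

lemma subsingleton_ext_succ_left (H : Function.Exact ι π)
    (hι : Function.Injective ι) (hπ : Function.Surjective π) (n : ℕ)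
    (hL : Subsingleton (ModuleExt R F L n)) (hQ : Subsingleton (ModuleExt R F Q (n + 1))) :
    Subsingleton (ModuleExt R F C (n + 1)) := by
  refine subsingleton_of_forall_eq 0 fun e ↦ ?_
  have hS := moduleShortComplex_shortExact H hι hπ
  obtain ⟨x, rfl⟩ := Ext.covariant_sequence_exact₁ _ hS e (Subsingleton.elim _ _) rfl
  rw [Subsingleton.elim x 0]
  simp

lemma subsingleton_ext_succ_of_projective (H : Function.Exact ι π)
    (hι : Function.Injective ι) (hπ : Function.Surjective π) [Module.Projective R Q] (n : ℕ)
    (hC : Subsingleton (ModuleExt R C F (n + 1))) :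
    Subsingleton (ModuleExt R L F (n + 2)) := by
  refine subsingleton_of_forall_eq 0 fun e ↦ ?_
  have hS := moduleShortComplex_shortExact H hι hπ
  have : Projective (ModuleCat.of R Q) :=
    (IsProjective.iff_projective (R := R) Q).1 inferInstance
  obtain ⟨x, rfl⟩ := Ext.contravariant_sequence_exact₃ hS _ e
    (Ext.eq_zero_of_projective _) (show 1 + (n + 1) = n + 2 by omega)
  rw [Subsingleton.elim x 0]
  simp

lemma subsingleton_ext_one_of_extend (H : Function.Exact ι π)
    (hι : Function.Injective ι) (hπ : Function.Surjective π) [Module.Projective R Q]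
    (hext : ∀ g : C →ₗ[R] F, ∃ h : Q →ₗ[R] F, h ∘ₗ ι = g) :
    Subsingleton (ModuleExt R L F 1) := by
  refine subsingleton_of_forall_eq 0 fun e ↦ ?_
  have hS := moduleShortComplex_shortExact H hι hπ
  have : Projective (ModuleCat.of R Q) :=
    (IsProjective.iff_projective (R := R) Q).1 inferInstance
  obtain ⟨x, rfl⟩ := Ext.contravariant_sequence_exact₃ hS _ e
    (Ext.eq_zero_of_projective _) (show 1 + 0 = 1 by omega)
  obtain ⟨g, rfl⟩ := (Ext.mk₀_bijective _ _).2 x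
  obtain ⟨h, hh⟩ := hext g.hom
  have : g = ModuleCat.ofHom ι ≫ ModuleCat.ofHom h := by
    ext x; simp [← hh]
  rw [this, ← Ext.mk₀_comp_mk₀]
  erw [hS.extClass_comp_assoc]

/-- If `Ext¹(F, Q) = 0` and `Ext¹(F, C)` is `r`-divisible because both `Ext¹(F, C / rC)` and
`Ext²(F, C[r])` vanish, then maps from `F` to the cokernel `L` of `C → Q` are divisible by `r` up
to maps that lift to `Q`. -/
lemma exists_eq_smul_add_of_ext (H : Function.Exact ι π)
    (hι : Function.Injective ι) (hπ : Function.Surjective π)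
    (hQ : Subsingleton (ModuleExt R F Q 1)) (r : R)
    (h₁ : Subsingleton (ModuleExt R F (C ⧸ LinearMap.range (LinearMap.lsmul R C r)) 1))
    (h₂ : Subsingleton (ModuleExt R F (LinearMap.ker (LinearMap.lsmul R C r)) 2))
    (g : F →ₗ[R] L) : ∃ (g' : F →ₗ[R] L) (h : F →ₗ[R] Q), g = r • g' + π ∘ₗ h := by
  have hS := moduleShortComplex_shortExact H hι hπ
  let m : C →ₗ[R] C := LinearMap.lsmul R C r
  have hA := moduleShortComplex_shortExact (LinearMap.exact_subtype_mkQ m.range)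
    m.range.injective_subtype m.range.mkQ_surjective
  have hB := moduleShortComplex_shortExact (ι := m.ker.subtype) (π := m.rangeRestrict)
    (fun x ↦ by simp [← LinearMap.mem_ker])
    m.ker.injective_subtype m.surjective_rangeRestrict
  let e : ModuleExt R F C 1 :=
    (Ext.mk₀ (ModuleCat.ofHom g)).comp hS.extClass (zero_add 1)
  -- Multiplication by `r` factors as C ↠ rC ↪ C. The two vanishing hypotheses pull the connecting
  -- class `e` back along each factor, so `e = r • e₂`; and `e₂` is again a connecting class because
  -- Ext¹(F, Q) = 0.
  obtain ⟨e₁, he₁⟩ := Ext.covariant_sequence_exact₂ _ hA e (Subsingleton.elim _ _)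
  obtain ⟨e₂, he₂⟩ := Ext.covariant_sequence_exact₃ _ hB e₁ (show 1 + 1 = 2 by rfl)
    (Subsingleton.elim _ _)
  obtain ⟨x, hx⟩ := Ext.covariant_sequence_exact₁ _ hS e₂ (Subsingleton.elim _ _) (zero_add 1)
  obtain ⟨g', rfl⟩ := (Ext.mk₀_bijective _ _).2 x
  have hm : r • 𝟙 (ModuleCat.of R C) =
    ModuleCat.ofHom m.rangeRestrict ≫ ModuleCat.ofHom m.range.subtype := by
    ext x; simp [m]
  have he : e = r • e₂ := by
    rw [Ext.smul_eq_comp_mk₀, hm, ← Ext.mk₀_comp_mk₀, ← Ext.comp_assoc_of_third_deg_zero]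
    rw [← he₁, ← he₂]
  have hz : (Ext.mk₀ (ModuleCat.ofHom g - r • g')).comp hS.extClass (zero_add 1) = 0 := by
    rw [sub_eq_add_neg, Ext.mk₀_add, Ext.add_comp, Ext.mk₀_neg, Ext.neg_comp, Ext.mk₀_smul,
      Ext.smul_comp, hx, ← he, add_neg_cancel]
  obtain ⟨x, hx⟩ := Ext.covariant_sequence_exact₃ _ hS _ (zero_add 1) hz
  obtain ⟨h, rfl⟩ := (Ext.mk₀_bijective _ _).2 x
  rw [Ext.mk₀_comp_mk₀] at hx
  have hx' := (Ext.mk₀_bijective _ _).1 hx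
  refine ⟨g'.hom, h.hom, ?_⟩
  ext x
  have := congr($(hx').hom x)
  simp only [ModuleCat.hom_comp, ModuleCat.hom_ofHom, LinearMap.comp_apply, ModuleCat.hom_sub,
    LinearMap.sub_apply, ModuleCat.hom_smul, LinearMap.smul_apply] at this
  simp [this]

end ExtModule

/-! ### Flat modules and torsion in injective modules -/

section Flat

variable {R : Type u} [CommRing R]

/-- For A ↪ B and K the kernel, A ⊗ K → A ⊗ P → B ⊗ P is injective, since H and P are flat; it
factors through A ⊗ K → B ⊗ K. -/
lemma Module.Flat.ker_of_surjective {P H : Type u} [AddCommGroup P] [Module R P]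
    [AddCommGroup H] [Module R H] [Module.Flat R P] [Module.Flat R H] (f : P →ₗ[R] H)
    (hf : Function.Surjective f) : Module.Flat R (LinearMap.ker f) := by
  refine (Module.Flat.iff_rTensor_preserves_injective_linearMap (M := LinearMap.ker f)).2 ?_
  intro A B _ _ _ _ j hj
  have h₁ := LinearMap.lTensor_injective_of_exact_of_flat f hf _ f.ker.injective_subtype
    (LinearMap.exact_subtype_ker_map f) A
  have h₂ := Module.Flat.rTensor_preserves_injective_linearMap (M := P) j hj
  have h₃ : Function.Injective ((f.ker.subtype.lTensor B) ∘ₗ (j.rTensor f.ker)) := by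
    rw [LinearMap.lTensor_comp_rTensor, ← LinearMap.rTensor_comp_lTensor]
    exact h₂.comp h₁
  exact Function.Injective.of_comp h₃

variable {M J : Type u} [AddCommGroup M] [Module R M] [AddCommGroup J] [Module R J]

/-- Maps into the `s`-torsion of `J` factor through `(R / s) ⊗ M`. -/
lemma exists_lift_quotient_tensor (s : Set R) (f : M →ₗ[R] Submodule.torsionBySet R J s) :
    ∃ f' : (R ⧸ Ideal.span s) ⊗[R] M →ₗ[R] J, ∀ m, f' (1 ⊗ₜ m) = f m := by
  refine ⟨TensorProduct.lift (Submodule.liftQ (Ideal.span s)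
    (LinearMap.toSpanSingleton R (M →ₗ[R] J) ((Submodule.torsionBySet R J s).subtype ∘ₗ f)) ?_),
    fun m ↦ ?_⟩
  · rw [Ideal.span, Submodule.span_le]
    intro r hr
    ext m
    simpa using (Submodule.mem_torsionBySet_iff _ _).1 (f m).2 ⟨r, hr⟩
  · rw [TensorProduct.lift.tmul, ← map_one (Ideal.Quotient.mk _)]
    erw [Submodule.liftQ_apply]
    simp

/-- Maps out of `(R / s) ⊗ M` restrict to maps from `M` into the `s`-torsion. -/
lemma exists_restrict_quotient_tensor (s : Set R) (f : (R ⧸ Ideal.span s) ⊗[R] M →ₗ[R] J) :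
    ∃ g : M →ₗ[R] Submodule.torsionBySet R J s, ∀ m, (g m : J) = f (1 ⊗ₜ m) := by
  refine ⟨LinearMap.codRestrict _ (f ∘ₗ TensorProduct.mk R _ _ 1) fun m ↦ ?_, fun m ↦ rfl⟩
  rw [Submodule.mem_torsionBySet_iff]
  rintro ⟨r, hr⟩
  have : algebraMap R (R ⧸ Ideal.span s) r = 0 :=
    Ideal.Quotient.eq_zero_iff_mem.2 (Ideal.subset_span hr)
  rw [LinearMap.comp_apply, ← map_smul, TensorProduct.mk_apply, TensorProduct.smul_tmul',
    Algebra.smul_def, this, zero_mul, TensorProduct.zero_tmul, map_zero]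

/-- `Ext¹` from a flat module to the `s`-torsion of an injective module vanishes. -/
lemma subsingleton_ext_one_torsionBySet (H : Type u) [AddCommGroup H] [Module R H]
    [Module.Flat R H] [Module.Injective R J] (s : Set R) :
    Subsingleton (ModuleExt R H (Submodule.torsionBySet R J s) 1) := by
  let p : (H →₀ R) →ₗ[R] H := Finsupp.linearCombination R id
  have hp : Function.Surjective p := Finsupp.linearCombination_id_surjective R H
  refine subsingleton_ext_one_of_extend (LinearMap.exact_subtype_ker_map p)
    (Submodule.injective_subtype _) hp ?_
  intro g
  obtain ⟨f, hf⟩ := exists_lift_quotient_tensor (M := p.ker) (J := J) s g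
  -- Flatness of `H` keeps the kernel inclusion injective after tensoring with R/(s), so a map from
  -- (R/s) ⊗ ker p to the injective `J` extends.
  have hinj := LinearMap.lTensor_injective_of_exact_of_flat (M := p.ker) p hp _
      p.ker.injective_subtype
      (LinearMap.exact_subtype_ker_map p) (R ⧸ Ideal.span s)
  obtain ⟨h, hh⟩ := Module.Injective.out _ hinj f
  obtain ⟨h', hh'⟩ := exists_restrict_quotient_tensor (M := H →₀ R) (J := J) s h
  refine ⟨h', ?_⟩
  ext m
  have := hh (1 ⊗ₜ m)
  rw [hf, LinearMap.lTensor_tmul] at this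
  simpa [hh'] using this

lemma subsingleton_ext_two_torsionBySet (H : Type u) [AddCommGroup H] [Module R H]
    [Module.Flat R H] [Module.Injective R J] (s : Set R) :
    Subsingleton (ModuleExt R H (Submodule.torsionBySet R J s) 2) := by
  let p : (H →₀ R) →ₗ[R] H := Finsupp.linearCombination R id
  have hp : Function.Surjective p := Finsupp.linearCombination_id_surjective R H
  have := Module.Flat.ker_of_surjective p hp
  exact subsingleton_ext_succ_of_projective (ι := p.ker.subtype) (π := p)
    (LinearMap.exact_subtype_ker_map p)
    p.ker.injective_subtype hp 0 (subsingleton_ext_one_torsionBySet p.ker s)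

/-- Every module embeds into an injective module. -/
lemma exists_injective_embedding (C : Type u) [AddCommGroup C] [Module R C] :
    ∃ (J : Type u) (_ : AddCommGroup J) (_ : Module R J), Module.Injective R J ∧
      ∃ ι : C →ₗ[R] J, Function.Injective ι := by
  have P := (EnoughInjectives.presentation (ModuleCat.of R C)).some
  refine ⟨P.J, inferInstance, inferInstance, ?_, P.f.hom, ?_⟩
  · have := P.injective
    exact Module.injective_module_of_injective_object R P.J
  · exact (ModuleCat.mono_iff_injective _).1 P.mono

/-- In the group of homomorphisms into an injective module, the equations
`r • k (n + 1) - k n = h n` can be solved. -/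
lemma exists_telescope_hom_injective [Module.Injective R J] (r : R) (h : ℕ → (M →ₗ[R] J)) :
    ∃ k : ℕ → (M →ₗ[R] J), ∀ n, r • k (n + 1) - k n = h n := by
  -- Hom(d, J) is the operator k ↦ (r • k (n + 1) - k n), so it is surjective once `d` is injective.
  let d₀ (n : ℕ) : M →ₗ[R] (ℕ →₀ M) := r • Finsupp.lsingle (n + 1) - Finsupp.lsingle n
  let d : (ℕ →₀ M) →ₗ[R] (ℕ →₀ M) := Finsupp.lsum ℕ d₀
  have hd0 (x : ℕ →₀ M) : d x 0 = - x 0 := by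
    induction x using Finsupp.induction_linear with
    | zero => simp
    | add x y hx hy => simp [hx, hy]; abel
    | single n a => simp [d, d₀, Finsupp.single_apply]
  have hd (x : ℕ →₀ M) (n : ℕ) : d x (n + 1) = r • x n - x (n + 1) := by
    induction x using Finsupp.induction_linear with
    | zero => simp
    | add x y hx hy => simp [hx, hy]; abel
    | single m a => simp [d, d₀, Finsupp.single_apply]
  have hinj : Function.Injective d := by
    rw [← LinearMap.ker_eq_bot, LinearMap.ker_eq_bot']
    intro x hx
    ext n
    induction n with
    | zero => simpa [hx] using (hd0 x).symm
    | succ n ih => simpa [hx, ih] using hd x n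
  obtain ⟨K, hK⟩ := Module.Injective.out d hinj (Finsupp.lsum ℕ h)
  refine ⟨fun n ↦ K ∘ₗ Finsupp.lsingle n, fun n ↦ ?_⟩
  ext m
  have := hK (Finsupp.single n m)
  have hr : K (Finsupp.single (n + 1) (r • m)) = r • K (Finsupp.single (n + 1) m) := by
    rw [← Finsupp.smul_single, map_smul]
  simpa [d, d₀, hr] using this

/-- In the group of homomorphisms into the `s`-torsion of an injective module,
the equations `r • k (n + 1) - k n = h n` can be solved. -/
lemma exists_telescope_hom [Module.Injective R J] (s : Set R) (r : R)
    (h : ℕ → (M →ₗ[R] Submodule.torsionBySet R J s)) :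
    ∃ k : ℕ → (M →ₗ[R] Submodule.torsionBySet R J s), ∀ n, r • k (n + 1) - k n = h n := by
  choose h' hh' using fun n : ℕ ↦
    exists_lift_quotient_tensor (M := M) (J := J) s (h n)
  obtain ⟨K, hK⟩ := exists_telescope_hom_injective r h'
  choose k hk using fun n : ℕ ↦ exists_restrict_quotient_tensor (M := M) (J := J) s (K n)
  refine ⟨k, fun n ↦ ?_⟩
  ext m
  simpa [hh', hk] using congr($(hK n) (1 ⊗ₜ m))

end Flat

/-! ### Maps out of R[r⁻¹] and contraadjusted modules -/

section Telescope

variable {R : Type u} [CommRing R]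

/-- The module of homomorphisms from `R[r⁻¹]` to `X`, as sequences `x` with
`r • x (n + 1) = x n`. -/
def telescope (r : R) (X : Type*) [AddCommGroup X] [Module R X] : Submodule R (ℕ → X) where
  carrier := {x | ∀ n, r • x (n + 1) = x n}
  add_mem' hx hy n := by simp [hx n, hy n]
  zero_mem' n := by simp
  smul_mem' c x hx n := by simp [smul_comm r c, hx n]

variable {X Y : Type*} [AddCommGroup X] [Module R X] [AddCommGroup Y] [Module R Y]

lemma telescope_pow_smul {r : R} (x : telescope r X) (n m : ℕ) : r ^ n • x.1 (n + m) = x.1 m := by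
  induction n with
  | zero => simp
  | succ n ih => rw [pow_succ, mul_smul, show n + 1 + m = n + m + 1 by ring, x.2, ih]

lemma telescope_smul_bijective (r : R) :
    Function.Bijective (LinearMap.lsmul R (telescope r X) r) := by
  constructor
  · rw [← LinearMap.ker_eq_bot, LinearMap.ker_eq_bot']
    intro x hx
    ext n
    rw [← x.2 n]
    exact congr($(congr(($hx).1)) (n + 1))
  · intro x
    refine ⟨⟨fun n ↦ x.1 (n + 1), fun n ↦ x.2 (n + 1)⟩, ?_⟩
    ext n
    exact x.2 n

lemma isUnit_algebraMap_end_of_bijective {r : R}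
    (h : Function.Bijective (LinearMap.lsmul R X r)) (x : Submonoid.powers r) :
    IsUnit (algebraMap R (Module.End R X) x) := by
  obtain ⟨_, n, rfl⟩ := x
  have : IsUnit (algebraMap R (Module.End R X) r) := (Module.End.isUnit_iff _).2 h
  simpa using this.pow n

/-- Compatible sequences are restrictions of maps out of the localization. -/
lemma exists_hom_away_of_telescope {r : R} (t : telescope r X) :
    ∃ g : Localization.Away r →ₗ[R] X,
      ∀ n, g (IsLocalization.Away.invSelf r ^ n) = t.1 n := by
  let G : Localization.Away r →ₗ[R] telescope r X :=
    IsLocalizedModule.lift (Submonoid.powers r) (Algebra.linearMap R (Localization.Away r))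
      (LinearMap.toSpanSingleton R _ t)
      (isUnit_algebraMap_end_of_bijective (telescope_smul_bijective r))
  have hG : G 1 = t := by
    have := IsLocalizedModule.lift_apply (Submonoid.powers r)
      (Algebra.linearMap R (Localization.Away r)) (LinearMap.toSpanSingleton R _ t)
      (isUnit_algebraMap_end_of_bijective (telescope_smul_bijective r)) 1
    simpa using this
  refine ⟨LinearMap.proj 0 ∘ₗ (telescope r X).subtype ∘ₗ G, fun n ↦ ?_⟩
  have h : r ^ n • (IsLocalization.Away.invSelf (S := Localization.Away r) r) ^ n = 1 := by
    rw [Algebra.smul_def, map_pow, ← mul_pow, IsLocalization.Away.mul_invSelf, one_pow]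
  rw [← hG, ← h, map_smul]
  simpa using (telescope_pow_smul (G (IsLocalization.Away.invSelf r ^ n)) n 0).symm

lemma smul_invSelf_pow_succ (r : R) (n : ℕ) :
    r • (IsLocalization.Away.invSelf (S := Localization.Away r) r) ^ (n + 1) =
      IsLocalization.Away.invSelf r ^ n := by
  rw [pow_succ', Algebra.smul_def, ← mul_assoc, IsLocalization.Away.mul_invSelf, one_mul]

lemma hom_away_ext {r : R} {g g' : Localization.Away r →ₗ[R] X}
    (h : ∀ n, g (IsLocalization.Away.invSelf r ^ n) = g' (IsLocalization.Away.invSelf r ^ n)) :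
    g = g' := by
  ext x
  obtain ⟨n, a, ha⟩ := IsLocalization.Away.surj r x
  have : x = a • IsLocalization.Away.invSelf (S := Localization.Away r) r ^ n := by
    rw [Algebra.smul_def, ← ha, mul_assoc, ← map_pow, map_pow, ← mul_pow,
      IsLocalization.Away.mul_invSelf, one_pow, mul_one]
  rw [this, map_smul, map_smul, h]

section Ext

variable {C D : Type u} [AddCommGroup C] [Module R C] [AddCommGroup D] [Module R D]

/-- R[r⁻¹] is the colimit of R → R → ⋯ along multiplication by r, so its Ext¹ into C is the lim¹ of
the corresponding tower of copies of C. -/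
lemma isContraadjustedAt_iff (r : R) :
    IsContraadjustedAt R r C ↔ ∀ c : ℕ → C, ∃ y : ℕ → C, ∀ n, r • y (n + 1) - y n = c n := by
  obtain ⟨J, _, _, _, ι, hι⟩ := exists_injective_embedding (R := R) C
  have H := LinearMap.exact_map_mkQ_range ι
  have hπ := ι.range.mkQ_surjective
  constructor
  · intro h c
    obtain ⟨k, hk⟩ := exists_telescope_hom_injective r
      fun n ↦ LinearMap.toSpanSingleton R J (ι (c n))
    replace hk (n : ℕ) : r • k (n + 1) 1 - k n 1 = ι (c n) := by
      simpa using congr($(hk n) 1)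
    obtain ⟨g, hg⟩ := exists_hom_away_of_telescope (r := r)
      ⟨fun n ↦ ι.range.mkQ (k n 1), fun n ↦ by
        rw [← sub_eq_zero, ← map_smul, ← map_sub, hk, H.apply_apply_eq_zero]⟩
    obtain ⟨h, rfl⟩ := exists_lift_of_subsingleton_ext_one H hι hπ h g
    have hy (n : ℕ) : ∃ y, ι y = k n 1 - h (IsLocalization.Away.invSelf r ^ n) := by
      rw [← Set.mem_range, ← H, map_sub, sub_eq_zero]
      exact (hg n).symm
    choose y hy using hy
    refine ⟨y, fun n ↦ hι ?_⟩
    rw [map_sub, map_smul, hy, hy, smul_sub, ← map_smul h, smul_invSelf_pow_succ, ← hk n]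
    abel
  · intro h
    refine subsingleton_ext_one_of_lift H hι hπ ?_ fun g ↦ ?_
    · have := Module.injective_object_of_injective_module R J
      exact Ext.subsingleton_of_injective _ _ _
    · choose j hj using fun n : ℕ ↦ hπ (g (IsLocalization.Away.invSelf r ^ n))
      have hc (n : ℕ) : ∃ c, ι c = r • j (n + 1) - j n := by
        rw [← Set.mem_range, ← H, map_sub, map_smul, hj, hj, ← map_smul,
          smul_invSelf_pow_succ, sub_self]
      choose c hc using hc
      obtain ⟨y, hy⟩ := h c
      obtain ⟨f, hf⟩ := exists_hom_away_of_telescope (r := r)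
        ⟨fun n ↦ j n - ι (y n), fun n ↦ by
          have := congr(ι $(hy n))
          rw [map_sub, map_smul, hc] at this
          rw [smul_sub, sub_eq_sub_iff_sub_eq_sub]
          rw [← sub_eq_zero] at this ⊢
          rw [← neg_eq_zero, ← this]
          abel⟩
      refine ⟨f, hom_away_ext fun n ↦ ?_⟩
      rw [LinearMap.comp_apply, hf, map_sub, hj, H.apply_apply_eq_zero, sub_zero]

/-- Solutions of the equations of `isContraadjustedAt_iff` push forward. This closure under
quotients drives both dévissage steps. -/
lemma IsContraadjusted.of_surjective (hC : IsContraadjusted R C) (f : C →ₗ[R] D)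
    (hf : Function.Surjective f) : IsContraadjusted R D := by
  intro r
  rw [isContraadjustedAt_iff]
  intro d
  choose c hc using fun n ↦ hf (d n)
  obtain ⟨y, hy⟩ := (isContraadjustedAt_iff r).1 (hC r) c
  exact ⟨fun n ↦ f (y n), fun n ↦ by rw [← map_smul, ← map_sub, hy, hc]⟩

lemma isContraadjusted_torsionBySet [Module.Injective R C] (s : Set R) :
    IsContraadjusted R (Submodule.torsionBySet R C s) := by
  intro r
  have : Module.Flat R (Localization.Away r) := IsLocalization.flat _ (Submonoid.powers r)
  exact subsingleton_ext_one_torsionBySet _ s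

variable {Q L : Type u} [AddCommGroup Q] [Module R Q] [AddCommGroup L] [Module R L]

/-- Composition with a linear map, on compatible sequences. -/
def telescopeMap (r : R) (π : X →ₗ[R] Y) : telescope r X →ₗ[R] telescope r Y :=
  (π.compLeft ℕ).restrict fun x hx n ↦ by simp [← map_smul, hx n]

lemma telescopeMap_surjective {r : R} (hC : IsContraadjustedAt R r C) {ι : C →ₗ[R] Q}
    {π : Q →ₗ[R] L} (H : Function.Exact ι π) (hι : Function.Injective ι)
    (hπ : Function.Surjective π) : Function.Surjective (telescopeMap r π) := by
  intro t
  obtain ⟨g, hg⟩ := exists_hom_away_of_telescope t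
  obtain ⟨h, rfl⟩ := exists_lift_of_subsingleton_ext_one H hι hπ hC g
  refine ⟨⟨fun n ↦ h (IsLocalization.Away.invSelf r ^ n), fun n ↦ ?_⟩, ?_⟩
  · rw [← map_smul, smul_invSelf_pow_succ]
  · ext n
    exact hg n

end Ext

end Telescope

/-! ### Generic freeness -/

section GenericFreeness

/-- Minimal elements form an antichain, which is finite by well-quasi-ordering. For exponents this
is Dickson's lemma. -/
lemma exists_finset_forall_exists_le {α : Type*} [PartialOrder α] [WellQuasiOrderedLE α]
    (D : Set α) : ∃ T : Finset α, (↑T ⊆ D) ∧ ∀ d ∈ D, ∃ t ∈ T, t ≤ d := by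
  have hfin : {t | Minimal (· ∈ D) t}.Finite :=
    WellQuasiOrderedLE.finite_of_isAntichain (setOfPred_minimal_antichain _)
  refine ⟨hfin.toFinset, fun t ht ↦ ?_, fun d hd ↦ ?_⟩
  · simpa using (hfin.mem_toFinset.1 ht).1
  · obtain ⟨t, htd, ht⟩ := exists_minimal_le_of_wellFoundedLT (· ∈ D) d hd
    exact ⟨t, by simpa using ht, htd⟩

/-- **Generic freeness**, in the form given by standard monomials: for an ideal `K` of a polynomial
ring over a domain `A`, there are a free `A`-submodule `N` meeting `K` trivially and a nonzero
`f : A` such that each polynomial has a multiple by a power of `f` in `N + K`. -/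
lemma exists_free_submodule_of_ideal {A : Type*} [CommRing A] [IsDomain A] {m : ℕ}
    (K : Ideal (MvPolynomial (Fin m) A)) :
    ∃ (N : Submodule A (MvPolynomial (Fin m) A)) (f : A), Module.Free A N ∧ f ≠ 0 ∧
      (∀ p ∈ N, p ∈ K → p = 0) ∧ ∀ p, ∃ n : ℕ, ∃ q ∈ N, f ^ n • p - q ∈ K := by
  classical
  let o : MonomialOrder (Fin m) := MonomialOrder.degLex
  let D : Set (Fin m →₀ ℕ) := {d | ∃ g ∈ K, g ≠ 0 ∧ o.degree g = d}
  obtain ⟨T, hTD, hT⟩ := exists_finset_forall_exists_le D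
  have hTg : ∀ t ∈ T, ∃ g ∈ K, g ≠ 0 ∧ o.degree g = t := fun t ht ↦ hTD ht
  choose! g hgK hg0 hgd using hTg
  -- Dividing by `g t` requires its leading coefficient to be invertible; finitely many `t` suffice,
  -- so one `f` serves all divisions.
  let f : A := ∏ t ∈ T, o.leadingCoeff (g t)
  refine ⟨MvPolynomial.restrictSupport A Dᶜ, f,
    .of_basis (MvPolynomial.basisRestrictSupport A Dᶜ), ?_, ?_, ?_⟩
  · rw [Finset.prod_ne_zero_iff]
    exact fun t ht ↦ o.leadingCoeff_ne_zero_iff.2 (hg0 t ht)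
  · intro p hp hpK
    by_contra h0
    exact (MvPolynomial.mem_restrictSupport_iff A).1 hp (o.degree_mem_support h0) ⟨p, hpK, h0, rfl⟩
  · suffices ∀ (s : o.syn) (p : MvPolynomial (Fin m) A), o.toSyn (o.degree p) = s →
        ∃ n : ℕ, ∃ q ∈ MvPolynomial.restrictSupport A Dᶜ, f ^ n • p - q ∈ K from
      fun p ↦ this _ p rfl
    intro s
    induction s using WellFoundedLT.induction with
    | ind s ih =>
    rintro p rfl
    -- Once the top coefficient is cancelled the degree drops strictly, except possibly for the zero
    -- polynomial, whose degree is 0 by convention.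
    have key (p' : MvPolynomial (Fin m) A) (hle : o.degree p' ≼[o] o.degree p)
        (hc : p'.coeff (o.degree p) = 0) :
        ∃ n : ℕ, ∃ q ∈ MvPolynomial.restrictSupport A Dᶜ, f ^ n • p' - q ∈ K := by
      by_cases h0 : p' = 0
      · exact ⟨0, 0, zero_mem _, by simp [h0]⟩
      · refine ih _ (lt_of_le_of_ne hle fun h ↦ ?_) p' rfl
        rw [← o.toSyn.injective h] at hc
        exact h0 (o.coeff_degree_eq_zero_iff.1 hc)
    by_cases hd : o.degree p ∈ D
    · obtain ⟨t, htT, htd⟩ := hT _ hd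
      obtain ⟨u, hu⟩ : o.leadingCoeff (g t) ∣ f := Finset.dvd_prod_of_mem _ htT
      let w := MvPolynomial.monomial (o.degree p - t) (u * o.leadingCoeff p) * g t
      have hwK : w ∈ K := K.mul_mem_left _ (hgK t htT)
      have hdeg : o.degree p = (o.degree p - t) + o.degree (g t) := by
        rw [hgd t htT, tsub_add_cancel_of_le htd]
      have hwd : o.degree w ≼[o] o.degree p := by
        refine o.degree_mul_le.trans ?_
        conv_rhs => rw [hdeg]
        rw [map_add, map_add]
        gcongr
        exact o.degree_monomial_le _
      have hwc : w.coeff (o.degree p) = f * o.leadingCoeff p := by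
        conv_lhs => rw [hdeg]
        rw [MvPolynomial.coeff_monomial_mul, hu]
        change _ * o.leadingCoeff (g t) = _
        ring
      have hle : o.degree (f • p - w) ≼[o] o.degree p := by
        rw [sub_eq_add_neg]
        refine o.degree_add_le.trans (sup_le o.degree_smul_le ?_)
        rwa [o.degree_neg]
      have hc : (f • p - w).coeff (o.degree p) = 0 := by
        rw [MvPolynomial.coeff_sub, hwc, MvPolynomial.coeff_smul]
        exact sub_self _
      obtain ⟨n, q, hq, hn⟩ := key _ hle hc
      refine ⟨n + 1, q, hq, ?_⟩
      have : f ^ (n + 1) • p - q = (f ^ n • (f • p - w) - q) + f ^ n • w := by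
        rw [smul_sub, smul_smul, pow_succ]; abel
      rw [this]
      exact K.add_mem hn (Submodule.smul_of_tower_mem K _ hwK)
    · have hN : MvPolynomial.monomial (o.degree p) (o.leadingCoeff p) ∈
          MvPolynomial.restrictSupport A Dᶜ :=
        (MvPolynomial.monomial_mem_restrictSupport A).2 (.inl hd)
      have hc : (p - MvPolynomial.monomial (o.degree p) (o.leadingCoeff p)).coeff
          (o.degree p) = 0 := by
        rw [MvPolynomial.coeff_sub, MvPolynomial.coeff_monomial, if_pos rfl]
        exact sub_self _
      obtain ⟨n, q, hq, hn⟩ := key _ (o.degree_sub_LTerm_le p) hc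
      refine ⟨n, q + f ^ n • MvPolynomial.monomial (o.degree p) (o.leadingCoeff p),
        add_mem hq (Submodule.smul_mem _ _ hN), ?_⟩
      convert hn using 1
      rw [MonomialOrder.subLTerm, smul_sub]; abel

/-- If `N → B` becomes an isomorphism after inverting `f`, with `N` projective, then maps from `B`
lift along surjections of modules on which `f` acts bijectively. -/
lemma exists_lift_of_projective_of_powers {A : Type*} [CommRing A] (f : A) {N B X Y : Type*}
    [AddCommGroup N] [Module A N] [AddCommGroup B] [Module A B] [AddCommGroup X] [Module A X]
    [AddCommGroup Y] [Module A Y] [Module.Projective A N] (θ : N →ₗ[A] B)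
    (hθ : Function.Injective θ) (hB : ∀ b, ∃ n : ℕ, ∃ x, θ x = f ^ n • b)
    (hX : Function.Bijective (LinearMap.lsmul A X f))
    (hY : Function.Bijective (LinearMap.lsmul A Y f))
    (π : X →ₗ[A] Y) (hπ : Function.Surjective π) (G : B →ₗ[A] Y) :
    ∃ H : B →ₗ[A] X, π ∘ₗ H = G := by
  let S := Submonoid.powers f
  let mk := LocalizedModule.mkLinearMap S B
  -- The localization of `B` is also that of `N`, so a lift on `N` extends uniquely to it.
  have hloc : IsLocalizedModule S (mk ∘ₗ θ) :=
    { map_units := IsLocalizedModule.map_units mk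
      surj := fun y ↦ by
        obtain ⟨⟨b, s⟩, hb⟩ := IsLocalizedModule.surj S mk y
        obtain ⟨n, x, hx⟩ := hB b
        refine ⟨(x, ⟨f ^ n, n, rfl⟩ * s), ?_⟩
        rw [mul_smul, hb, LinearMap.comp_apply, hx, map_smul]
        rfl
      exists_of_eq := fun {x₁ x₂} h ↦ by
        obtain ⟨c, hc⟩ := IsLocalizedModule.exists_of_eq (S := S) (f := mk) h
        refine ⟨c, hθ ?_⟩
        simpa [Submonoid.smul_def] using hc }
  obtain ⟨h, hh⟩ := Module.projective_lifting_property π (G ∘ₗ θ) hπ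
  have hX' := isUnit_algebraMap_end_of_bijective hX
  have hY' := isUnit_algebraMap_end_of_bijective hY
  have h₁ := IsLocalizedModule.lift_comp S (mk ∘ₗ θ) h hX'
  have h₂ := IsLocalizedModule.lift_comp S mk G hY'
  refine ⟨IsLocalizedModule.lift S (mk ∘ₗ θ) h hX' ∘ₗ mk, ?_⟩
  rw [← h₂, ← LinearMap.comp_assoc]
  congr 1
  refine IsLocalizedModule.ext S (mk ∘ₗ θ) hY' ?_
  rw [LinearMap.comp_assoc, h₁, hh, ← LinearMap.comp_assoc, h₂]

lemma exists_forall_lift_of_isDomain (A B : Type*) [CommRing A] [IsDomain A] [CommRing B]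
    [Algebra A B] [Algebra.FiniteType A B] : ∃ f : A, f ≠ 0 ∧
      ∀ (X Y : Type u) [AddCommGroup X] [Module A X] [AddCommGroup Y] [Module A Y]
        (_ : Function.Bijective (LinearMap.lsmul A X f))
        (_ : Function.Bijective (LinearMap.lsmul A Y f))
        (π : X →ₗ[A] Y) (_ : Function.Surjective π) (G : B →ₗ[A] Y),
        ∃ H : B →ₗ[A] X, π ∘ₗ H = G := by
  obtain ⟨m, φ, hφ⟩ := Algebra.FiniteType.iff_quotient_mvPolynomial''.1 ‹Algebra.FiniteType A B›
  obtain ⟨N, f, hN, hf, hNK, hp⟩ := exists_free_submodule_of_ideal (RingHom.ker φ)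
  refine ⟨f, hf, fun X Y _ _ _ _ hX hY π hπ G ↦ ?_⟩
  refine exists_lift_of_projective_of_powers f (φ.toLinearMap ∘ₗ N.subtype) ?_ (fun b ↦ ?_)
    hX hY π hπ G
  · rw [← LinearMap.ker_eq_bot, LinearMap.ker_eq_bot']
    exact fun x hx ↦ Subtype.ext (hNK x x.2 hx)
  · obtain ⟨p, rfl⟩ := hφ b
    obtain ⟨n, q, hq, hn⟩ := hp p
    refine ⟨n, ⟨q, hq⟩, ?_⟩
    rw [RingHom.mem_ker, map_sub, sub_eq_zero, map_smul] at hn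
    exact hn.symm

/-- Modules killed by I are R₀/I-modules, and maps to them from S₀ are R₀/I-linear maps from (R₀/I)
⊗ S₀, so the domain case applies. -/
lemma exists_forall_lift_of_isPrime (R₀ S₀ : Type*) [CommRing R₀] [CommRing S₀]
    [Algebra R₀ S₀] [Algebra.FiniteType R₀ S₀] (I : Ideal R₀) [I.IsPrime] : ∃ f : R₀, f ∉ I ∧
      ∀ (X Y : Type u) [AddCommGroup X] [Module R₀ X] [AddCommGroup Y] [Module R₀ Y]
        (_ : Module.IsTorsionBySet R₀ X I) (_ : Module.IsTorsionBySet R₀ Y I)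
        (_ : Function.Bijective (LinearMap.lsmul R₀ X f))
        (_ : Function.Bijective (LinearMap.lsmul R₀ Y f))
        (π : X →ₗ[R₀] Y) (_ : Function.Surjective π) (G : S₀ →ₗ[R₀] Y),
        ∃ H : S₀ →ₗ[R₀] X, π ∘ₗ H = G := by
  obtain ⟨f, hf, h⟩ := exists_forall_lift_of_isDomain.{u} (R₀ ⧸ I) ((R₀ ⧸ I) ⊗[R₀] S₀)
  obtain ⟨f, rfl⟩ := Ideal.Quotient.mk_surjective f
  refine ⟨f, fun hfI ↦ hf (Ideal.Quotient.eq_zero_iff_mem.2 hfI),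
    fun X Y _ _ _ _ hXI hYI hX hY π hπ G ↦ ?_⟩
  let _ : Module (R₀ ⧸ I) X := hXI.module
  let _ : Module (R₀ ⧸ I) Y := hYI.module
  have : IsScalarTower R₀ (R₀ ⧸ I) X := hXI.isScalarTower
  have : IsScalarTower R₀ (R₀ ⧸ I) Y := hYI.isScalarTower
  obtain ⟨H, hH⟩ := h X Y hX hY (π.extendScalarsOfSurjective Ideal.Quotient.mk_surjective) hπ
    (G.liftBaseChange (R₀ ⧸ I))
  refine ⟨H.restrictScalars R₀ ∘ₗ TensorProduct.mk R₀ _ _ 1, ?_⟩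
  ext s
  simpa using congr($hH (1 ⊗ₜ s))

/-- A form of generic freeness for a finite type algebra `S₀` over `R₀`, base changed to `R`. -/
lemma exists_forall_lift_baseChange {R₀ S₀ R S : Type*} [CommRing R₀] [CommRing S₀]
    [Algebra R₀ S₀] [Algebra.FiniteType R₀ S₀] [CommRing R] [Algebra R₀ R] [CommRing S]
    [Algebra R S] (e : R ⊗[R₀] S₀ ≃ₗ[R] S) (I : Ideal R₀) [I.IsPrime] :
    ∃ f : R₀, f ∉ I ∧
      ∀ (X Y : Type u) [AddCommGroup X] [Module R X] [AddCommGroup Y] [Module R Y]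
        (_ : Module.IsTorsionBySet R X (algebraMap R₀ R '' I))
        (_ : Module.IsTorsionBySet R Y (algebraMap R₀ R '' I))
        (_ : Function.Bijective (LinearMap.lsmul R X (algebraMap R₀ R f)))
        (_ : Function.Bijective (LinearMap.lsmul R Y (algebraMap R₀ R f)))
        (π : X →ₗ[R] Y) (_ : Function.Surjective π) (G : S →ₗ[R] Y),
        ∃ H : S →ₗ[R] X, π ∘ₗ H = G := by
  obtain ⟨f, hf, h⟩ := exists_forall_lift_of_isPrime.{u} R₀ S₀ I
  refine ⟨f, hf, fun X Y _ _ _ _ hXI hYI hX hY π hπ G ↦ ?_⟩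
  let _ : Module R₀ X := Module.compHom X (algebraMap R₀ R)
  let _ : Module R₀ Y := Module.compHom Y (algebraMap R₀ R)
  let _ : Module R₀ S := Module.compHom S (algebraMap R₀ R)
  have : IsScalarTower R₀ R S := .of_algebraMap_smul fun _ _ ↦ rfl
  have : IsScalarTower R₀ R X := .of_algebraMap_smul fun _ _ ↦ rfl
  have : IsScalarTower R₀ R Y := .of_algebraMap_smul fun _ _ ↦ rfl
  obtain ⟨H, hH⟩ := h X Y (fun x i ↦ @hXI x ⟨_, i, i.2, rfl⟩) (fun x i ↦ @hYI x ⟨_, i, i.2, rfl⟩)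
    hX hY (π.restrictScalars R₀) hπ
    (G.restrictScalars R₀ ∘ₗ e.toLinearMap.restrictScalars R₀ ∘ₗ TensorProduct.mk R₀ _ _ 1)
  refine ⟨H.liftBaseChange R ∘ₗ e.symm.toLinearMap, ?_⟩
  suffices π ∘ₗ H.liftBaseChange R = G ∘ₗ e.toLinearMap by
    rw [← LinearMap.comp_assoc, this, LinearMap.comp_assoc]
    ext; simp
  ext s
  simpa using congr($hH s)

end GenericFreeness

/-! ### Dévissage and Noetherian induction -/

section Main

variable {R : Type u} [CommRing R]

lemma exists_embedding_torsionBySet {C : Type u} [AddCommGroup C] [Module R C] {s : Set R}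
    (hC : Module.IsTorsionBySet R C s) :
    ∃ (J : Type u) (_ : AddCommGroup J) (_ : Module R J), Module.Injective R J ∧
      ∃ ι : C →ₗ[R] Submodule.torsionBySet R J s, Function.Injective ι := by
  obtain ⟨J, _, _, hJ, ι, hι⟩ := exists_injective_embedding (R := R) C
  refine ⟨J, inferInstance, inferInstance, hJ, ι.codRestrict _ fun c ↦ ?_,
    (LinearMap.injective_codRestrict_iff _).2 hι⟩
  rw [Submodule.mem_torsionBySet_iff]
  intro a
  rw [← map_smul, hC, map_zero]

lemma Module.IsTorsionBySet.of_surjective {C D : Type*} [AddCommGroup C] [Module R C]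
    [AddCommGroup D] [Module R D] {s : Set R} (hC : Module.IsTorsionBySet R C s) (f : C →ₗ[R] D)
    (hf : Function.Surjective f) : Module.IsTorsionBySet R D s := by
  intro d a
  obtain ⟨c, rfl⟩ := hf d
  rw [← map_smul, hC, map_zero]

lemma Module.IsTorsionBySet.of_injective {C D : Type*} [AddCommGroup C] [Module R C]
    [AddCommGroup D] [Module R D] {s : Set R} (hD : Module.IsTorsionBySet R D s) (f : C →ₗ[R] D)
    (hf : Function.Injective f) : Module.IsTorsionBySet R C s :=
  fun c a ↦ hf (by rw [map_smul, hD, map_zero])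

lemma isTorsionBySet_telescope {X : Type*} [AddCommGroup X] [Module R X] {s : Set R}
    (hX : Module.IsTorsionBySet R X s) (r : R) : Module.IsTorsionBySet R (telescope r X) s :=
  fun x a ↦ by ext n; exact @hX (x.1 n) a

lemma Module.IsTorsionBySet.insert {C : Type*} [AddCommGroup C] [Module R C] {s : Set R} {r : R}
    (hC : Module.IsTorsionBySet R C s) (hr : ∀ c : C, r • c = 0) :
    Module.IsTorsionBySet R C (insert r s) := by
  rintro c ⟨a, rfl | ha⟩
  · exact hr c
  · exact @hC c ⟨a, ha⟩

/-- Dévissage along `r`: if `Ext¹(F, -)` vanishes on the contraadjusted modules killed by `s` and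
`r`, and maps from `F` lift along surjections of modules killed by `s` on which `r` is bijective,
then `Ext¹(F, -)` vanishes on the contraadjusted modules killed by `s`. -/
lemma subsingleton_ext_one_of_forall_lift (F : Type u) [AddCommGroup F] [Module R F]
    [Module.Flat R F] (s : Set R) (r : R)
    (hlift : ∀ (X Y : Type u) [AddCommGroup X] [Module R X] [AddCommGroup Y] [Module R Y]
      (_ : Module.IsTorsionBySet R X s) (_ : Module.IsTorsionBySet R Y s)
      (_ : Function.Bijective (LinearMap.lsmul R X r))
      (_ : Function.Bijective (LinearMap.lsmul R Y r))
      (π : X →ₗ[R] Y) (_ : Function.Surjective π) (G : F →ₗ[R] Y),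
      ∃ H : F →ₗ[R] X, π ∘ₗ H = G)
    (hr : ∀ (D : Type u) [AddCommGroup D] [Module R D], IsContraadjusted R D →
      Module.IsTorsionBySet R D (insert r s) → Subsingleton (ModuleExt R F D 1))
    (C : Type u) [AddCommGroup C] [Module R C] (hC : IsContraadjusted R C)
    (hCs : Module.IsTorsionBySet R C s) : Subsingleton (ModuleExt R F C 1) := by
  obtain ⟨J, _, _, _, ι, hι⟩ := exists_embedding_torsionBySet hCs
  have H := LinearMap.exact_map_mkQ_range ι
  have hπ := ι.range.mkQ_surjective
  set π := ι.range.mkQ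
  have hQ := subsingleton_ext_one_torsionBySet (J := J) F s
  have hQs : Module.IsTorsionBySet R (Submodule.torsionBySet R J s) s :=
    Submodule.torsionBySet_isTorsionBySet s
  have h₁ : Subsingleton (ModuleExt R F (C ⧸ LinearMap.range (LinearMap.lsmul R C r)) 1) := by
    refine hr _ (hC.of_surjective _ (Submodule.mkQ_surjective _))
      ((hCs.of_surjective _ (Submodule.mkQ_surjective _)).insert fun c ↦ ?_)
    obtain ⟨c, rfl⟩ := Submodule.mkQ_surjective _ c
    rw [← map_smul, Submodule.mkQ_apply, Submodule.Quotient.mk_eq_zero]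
    exact ⟨c, rfl⟩
  -- C[r] need not be contraadjusted. Dimension shifting replaces it by a quotient of the torsion of
  -- an injective module, which is.
  have h₂ : Subsingleton (ModuleExt R F (LinearMap.ker (LinearMap.lsmul R C r)) 2) := by
    have hD : Module.IsTorsionBySet R (LinearMap.ker (LinearMap.lsmul R C r)) (insert r s) :=
      (hCs.of_injective _ (Submodule.injective_subtype _)).insert fun c ↦ Subtype.ext c.2
    obtain ⟨J', _, _, _, ι', hι'⟩ := exists_embedding_torsionBySet hD
    refine subsingleton_ext_succ_left (LinearMap.exact_map_mkQ_range ι') hι'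
      ι'.range.mkQ_surjective 1 (hr _ ?_ ?_) (subsingleton_ext_two_torsionBySet F _)
    · exact (isContraadjusted_torsionBySet _).of_surjective _ ι'.range.mkQ_surjective
    · exact (Submodule.torsionBySet_isTorsionBySet _).of_surjective _ ι'.range.mkQ_surjective
  refine subsingleton_ext_one_of_lift H hι hπ hQ fun g ↦ ?_
  choose next rem hdiv using exists_eq_smul_add_of_ext H hι hπ hQ r h₁ h₂
  let G (n : ℕ) : F →ₗ[R] _ := next^[n] g
  have hG (n : ℕ) : G n = r • G (n + 1) + π ∘ₗ rem (G n) := by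
    simp only [G, Function.iterate_succ_apply']
    exact hdiv _
  -- The maps `k n` absorb the remainders: `G n + π ∘ₗ k n` is a compatible sequence, hence a map
  -- `T` into the telescope.
  obtain ⟨k, hk⟩ := exists_telescope_hom s r fun n ↦ rem (G n)
  let T : F →ₗ[R] telescope r (Submodule.torsionBySet R J s ⧸ ι.range) :=
    LinearMap.codRestrict _ (LinearMap.pi fun n ↦ G n + π ∘ₗ k n) fun x n ↦ by
      have h₁ := congr($(hG n) x)
      have h₂ := congr(π ($(hk n) x))
      simp only [LinearMap.add_apply, LinearMap.smul_apply, LinearMap.comp_apply,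
        LinearMap.sub_apply, map_sub, map_smul, LinearMap.pi_apply, smul_add] at h₁ h₂ ⊢
      rw [h₁, ← h₂]
      abel
  obtain ⟨h, hh⟩ := hlift _ _ (isTorsionBySet_telescope hQs r)
    (isTorsionBySet_telescope (hQs.of_surjective π hπ) r)
    (telescope_smul_bijective r) (telescope_smul_bijective r) (telescopeMap r π)
    (telescopeMap_surjective (hC r) H hι hπ) T
  -- Term 0 of `T` is `g + π ∘ₗ k 0`, so `k 0` is subtracted from term 0 of its lift.
  refine ⟨LinearMap.proj 0 ∘ₗ (telescope r _).subtype ∘ₗ h - k 0, ?_⟩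
  ext x
  have := congr(($hh x).1 0)
  change π ((h x).1 0) = g x + π (k 0 x) at this
  change π ((h x).1 0 - k 0 x) = g x
  rw [map_sub, this, add_sub_cancel_right]

lemma Module.IsTorsionBySet.image_iff_le {R₀ : Type*} [CommRing R₀] [Algebra R₀ R] {C : Type*}
    [AddCommGroup C] [Module R C] {I : Ideal R₀} :
    Module.IsTorsionBySet R C (algebraMap R₀ R '' I) ↔
      I ≤ (Module.annihilator R C).comap (algebraMap R₀ R) := by
  refine ⟨fun h i hi ↦ ?_, fun h c ⟨_, i, hi, hr⟩ ↦ ?_⟩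
  · exact Module.mem_annihilator.2 fun c ↦ @h c ⟨_, i, hi, rfl⟩
  · subst hr
    exact Module.mem_annihilator.1 (h hi) c

lemma subsingleton_ext_one_of_baseChange {R₀ S₀ : Type*} [CommRing R₀] [IsNoetherianRing R₀]
    [CommRing S₀] [Algebra R₀ S₀] [Algebra.FiniteType R₀ S₀] [Algebra R₀ R] {S : Type u}
    [CommRing S] [Algebra R S] [Module.Flat R S] (e : R ⊗[R₀] S₀ ≃ₗ[R] S) (I : Ideal R₀) :
    ∀ (C : Type u) [AddCommGroup C] [Module R C], IsContraadjusted R C →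
      I ≤ (Module.annihilator R C).comap (algebraMap R₀ R) →
      Subsingleton (ModuleExt R S C 1) := by
  induction I using WellFoundedGT.induction with
  | ind I ih =>
  intro C _ _ hC hCI
  have hlt {a : R₀} (ha : a ∉ I) : I < I ⊔ Ideal.span {a} :=
    lt_of_le_of_ne le_sup_left fun h ↦ ha
      (h ▸ Ideal.mem_sup_right (Ideal.mem_span_singleton_self a))
  by_cases hI : I.IsPrime
  · obtain ⟨f, hf, hlift⟩ := exists_forall_lift_baseChange.{u} e I
    refine subsingleton_ext_one_of_forall_lift S (algebraMap R₀ R '' I) (algebraMap R₀ R f) hlift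
      (fun D _ _ hD hDf ↦ ih _ (hlt hf) D hD ?_) C hC
      (Module.IsTorsionBySet.image_iff_le.2 hCI)
    refine sup_le (Module.IsTorsionBySet.image_iff_le.1
      fun d a ↦ @hDf d ⟨a, Set.mem_insert_of_mem _ a.2⟩) ?_
    rw [Ideal.span_singleton_le_iff_mem]
    exact Module.mem_annihilator.2 fun d ↦ @hDf d ⟨_, Set.mem_insert _ _⟩
  · rw [Ideal.not_isPrime_iff] at hI
    obtain rfl | ⟨a, ha, b, hb, hab⟩ := hI
    · have : Subsingleton C := Module.annihilator_eq_top_iff.1 <| by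
        rw [← Ideal.comap_eq_top_iff (f := algebraMap R₀ R)]
        exact top_le_iff.1 hCI
      have : Module.Injective R C := ⟨fun _ _ _ _ _ _ _ _ _ ↦ ⟨0, fun _ ↦ Subsingleton.elim _ _⟩⟩
      have := Module.injective_object_of_injective_module R C
      exact Ext.subsingleton_of_injective _ _ _
    · let m : C →ₗ[R] C := LinearMap.lsmul R C (algebraMap R₀ R a)
      refine subsingleton_ext_middle (LinearMap.exact_subtype_mkQ m.range)
        m.range.injective_subtype m.range.mkQ_surjective 1
        (ih _ (hlt hb) _ (hC.of_surjective m.rangeRestrict m.surjective_rangeRestrict)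
          (sup_le (hCI.trans ?_) ?_))
        (ih _ (hlt ha) _ (hC.of_surjective _ m.range.mkQ_surjective)
          (sup_le (hCI.trans ?_) ?_))
      · exact Ideal.comap_mono
          (LinearMap.annihilator_le_of_injective _ m.range.injective_subtype)
      · rw [Ideal.span_singleton_le_iff_mem]
        refine Module.mem_annihilator.2 ?_
        rintro ⟨_, c, rfl⟩
        ext
        have := Module.mem_annihilator.1 (hCI hab) c
        rw [mul_comm, map_mul, mul_smul] at this
        exact this
      · exact Ideal.comap_mono
          (LinearMap.annihilator_le_of_surjective _ m.range.mkQ_surjective)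
      · rw [Ideal.span_singleton_le_iff_mem]
        refine Module.mem_annihilator.2 fun c ↦ ?_
        obtain ⟨c, rfl⟩ := m.range.mkQ_surjective c
        rw [← map_smul, Submodule.mkQ_apply, Submodule.Quotient.mk_eq_zero]
        exact ⟨c, rfl⟩

end Main

/-- A finitely presented commutative algebra that is flat as a module is a very flat module. -/
theorem theorem1p1 (R : Type u) [CommRing R] (S : Type u) [CommRing S] [Algebra R S]
    [Algebra.FinitePresentation R S] [Module.Flat R S] : IsVeryFlat R S := by
  intro C _ _ hC
  -- The core is a finitely generated ℤ-algebra containing the coefficients of the relations, hence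
  -- Noetherian.
  let P := Algebra.Presentation.ofFinitePresentation R S
  have : IsNoetherianRing P.Core := Algebra.FiniteType.isNoetherianRing ℤ P.Core
  exact subsingleton_ext_one_of_baseChange (P.tensorModelOfHasCoeffsEquiv P.Core).toLinearEquiv
    ⊥ C hC bot_le
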